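/- Index the Fibonacci numbers by $F_1=1$, $F_2=2$ and $F_k=F_{k-1}+F_{k-2}$ for $k\ge 3$. Let $N\ge 1$ be an integer. The Zeckendorf game on input $N$ is played on a multiset of Fibonacci numbers, which initially consists of $N$ copies of $F_1$. The available moves are: for $k\ge 2$, replace one $F_{k-1}$ and one $F_k$ by one $F_{k+1}$; replace two copies of $F_1$ by one $F_2$; replace two copies of $F_2$ by one $F_1$ and one $F_3$; for $k\ge 3$, replace two copies of $F_k$ by one $F_{k-2}$ and one $F_{k+1}$. A game is a finite sequence of moves from the initial multiset to a multiset on which no move is available, and its length is its number of moves. Let $Z(N)$ be the number of terms in the Zeckendorf decomposition of $N$ (its unique decomposition as a sum of distinct, pairwise non-consecutive Fibonacci numbers). **Theorem.** There is a longest Zeckendorf game on input $N$; let $M$ be its length. For every integer $m$ with $N-Z(N)\le m\le M$ there is a Zeckendorf game on input $N$ of length $m$, and every Zeckendorf game on input $N$ has length in this range. In other words, the set of achievable game lengths is exactly the interval $\{m\in\mathbb Z : N-Z(N)\le m\le M\}$. -/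

import Mathlib

namespace ZeckendorfGame

/-- The Fibonacci numbers indexed by `F 1 = 1`, `F 2 = 2`, `F (k + 2) = F (k + 1) + F k`. -/
def F (k : ℕ) : ℕ := Nat.fib (k + 1)

/-- `Move s t`: a player facing the multiset `s` of Fibonacci numbers can turn it into `t` by a
single move of the Zeckendorf game. In each constructor, `s` is the multiset of pieces that the
move does not touch. -/
inductive Move : Multiset ℕ → Multiset ℕ → Prop
  /-- `F (k - 1) ∧ F k → F (k + 1)`, for `k ≥ 2`. -/
  | combine (k : ℕ) (hk : 2 ≤ k) (s : Multiset ℕ) :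
      Move (F (k - 1) ::ₘ F k ::ₘ s) (F (k + 1) ::ₘ s)
  /-- `F 1 ∧ F 1 → F 2`. -/
  | combineOnes (s : Multiset ℕ) :
      Move (F 1 ::ₘ F 1 ::ₘ s) (F 2 ::ₘ s)
  /-- `F 2 ∧ F 2 → F 1 ∧ F 3`. -/
  | splitTwos (s : Multiset ℕ) :
      Move (F 2 ::ₘ F 2 ::ₘ s) (F 1 ::ₘ F 3 ::ₘ s)
  /-- `F k ∧ F k → F (k - 2) ∧ F (k + 1)`, for `k ≥ 3`. -/
  | split (k : ℕ) (hk : 3 ≤ k) (s : Multiset ℕ) :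
      Move (F k ::ₘ F k ::ₘ s) (F (k - 2) ::ₘ F (k + 1) ::ₘ s)

/-- A (complete) Zeckendorf game on input `N`: a finite sequence of positions, each obtained from
the previous one by a move, that starts at `N` copies of `F 1` and ends at a position where no move
is available. Its `length` is the number of moves played (one less than the number of
positions). -/
structure Game (N : ℕ) extends RelSeries {p : Multiset ℕ × Multiset ℕ | Move p.1 p.2} where
  start : toRelSeries.head = Multiset.replicate N (F 1)
  terminal : ∀ t, ¬ Move toRelSeries.last t

/-- The set of lengths (numbers of moves) of the Zeckendorf games on input `N`. -/
def gameLengths (N : ℕ) : Set ℕ := Set.range fun g : Game N => g.length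

/-- `Z N`: the number of terms in the Zeckendorf decomposition of `N`. -/
def Z (N : ℕ) : ℕ := (Nat.zeckendorf N).length

end ZeckendorfGame

namespace ZeckendorfGame

/-! A combining move loses one piece and a splitting move none. Every game ends at the Zeckendorf
decomposition (`card_of_terminal`), so it has exactly N - Z(N) combining moves, and its length
varies only with the number of splits. It thus suffices to lower that number one at a time, keeping
the final position (`Play.remove_split`). Before the first split, on F k ∧ F k, only combining moves
occur, so the move that made one F k can be omitted (`Play.uncombine`). Combining the resulting F (k
- 1) with the other F k then gives the outcome of the split. A longest game exists because `sumSq`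
grows and is at most N ^ 2. -/

/-- A combining move. As `F 0 = F 1 = 1`, the index `k = 1` covers the move `1 ∧ 1 → 2`. -/
def Combine (s t : Multiset ℕ) : Prop :=
  ∃ k u, 1 ≤ k ∧ s = F (k - 1) ::ₘ F k ::ₘ u ∧ t = F (k + 1) ::ₘ u

/-- A splitting move. As `F 0 = F 1 = 1`, the index `k = 2` covers the move `2 ∧ 2 → 1 ∧ 3`. -/
def Split (s t : Multiset ℕ) : Prop :=
  ∃ k u, 2 ≤ k ∧ s = F k ::ₘ F k ::ₘ u ∧ t = F (k - 2) ::ₘ F (k + 1) ::ₘ u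

theorem move_iff {s t : Multiset ℕ} : Move s t ↔ Combine s t ∨ Split s t := by
  constructor
  · rintro (⟨k, hk, u⟩ | u | u | ⟨k, hk, u⟩)
    · exact Or.inl ⟨k, u, by omega, rfl, rfl⟩
    · exact Or.inl ⟨1, u, le_rfl, rfl, rfl⟩
    · exact Or.inr ⟨2, u, le_rfl, rfl, rfl⟩
    · exact Or.inr ⟨k, u, by omega, rfl, rfl⟩
  · rintro (⟨k, u, hk, rfl, rfl⟩ | ⟨k, u, hk, rfl, rfl⟩)
    · obtain rfl | hk := hk.eq_or_lt
      · exact Move.combineOnes u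
      · exact Move.combine k hk u
    · obtain rfl | hk := hk.eq_or_lt
      · exact Move.splitTwos u
      · exact Move.split k hk u

theorem F_add_two (k : ℕ) : F (k + 2) = F k + F (k + 1) := Nat.fib_add_two

theorem F_pos (k : ℕ) : 0 < F k := Nat.fib_pos.2 k.succ_pos

theorem F_lt_F {j k : ℕ} (hj : 1 ≤ j) (h : j < k) : F j < F k :=
  (Nat.fib_lt_fib (by omega)).2 (by omega)

theorem F_inj {j k : ℕ} (hj : 1 ≤ j) (hk : 1 ≤ k) (h : F j = F k) : j = k := by
  rcases lt_trichotomy j k with hl | rfl | hl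
  · exact absurd h (F_lt_F hj hl).ne
  · rfl
  · exact absurd h (F_lt_F hk hl).ne'

theorem Combine.sum_eq {s t : Multiset ℕ} (h : Combine s t) : t.sum = s.sum := by
  obtain ⟨k, u, hk, rfl, rfl⟩ := h
  obtain ⟨k, rfl⟩ := Nat.exists_eq_add_of_le' hk
  simp [F_add_two, add_assoc]

theorem Split.sum_eq {s t : Multiset ℕ} (h : Split s t) : t.sum = s.sum := by
  obtain ⟨k, u, hk, rfl, rfl⟩ := h
  obtain ⟨k, rfl⟩ := Nat.exists_eq_add_of_le' hk
  have h₁ := F_add_two k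
  have h₂ : F (k + 2 + 1) = F (k + 1) + F (k + 2) := F_add_two (k + 1)
  simp only [Multiset.sum_cons, Nat.add_sub_cancel]
  omega

theorem Combine.card_eq {s t : Multiset ℕ} (h : Combine s t) : s.card = t.card + 1 := by
  obtain ⟨k, u, hk, rfl, rfl⟩ := h
  simp

theorem Split.card_eq {s t : Multiset ℕ} (h : Split s t) : s.card = t.card := by
  obtain ⟨k, u, hk, rfl, rfl⟩ := h
  simp

/-- The sum of the squares of the pieces: every move increases it. -/
def sumSq (s : Multiset ℕ) : ℕ := (s.map (· ^ 2)).sum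

theorem Combine.sumSq_lt {s t : Multiset ℕ} (h : Combine s t) : sumSq s < sumSq t := by
  obtain ⟨k, u, hk, rfl, rfl⟩ := h
  obtain ⟨k, rfl⟩ := Nat.exists_eq_add_of_le' hk
  have := Nat.mul_pos (F_pos k) (F_pos (k + 1))
  simp only [sumSq, Multiset.map_cons, Multiset.sum_cons, Nat.add_sub_cancel, F_add_two]
  nlinarith

theorem Split.sumSq_lt {s t : Multiset ℕ} (h : Split s t) : sumSq s < sumSq t := by
  obtain ⟨k, u, hk, rfl, rfl⟩ := h
  obtain ⟨k, rfl⟩ := Nat.exists_eq_add_of_le' hk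
  -- After the shift of `k`, the increase is exactly 2 * F (k + 1) ^ 2.
  have := Nat.mul_pos (F_pos (k + 1)) (F_pos (k + 1))
  simp only [sumSq, Multiset.map_cons, Multiset.sum_cons, Nat.add_sub_cancel, F_add_two k,
    F_add_two (k + 1)]
  nlinarith

theorem sumSq_le (s : Multiset ℕ) : sumSq s ≤ s.sum ^ 2 := by
  induction s using Multiset.induction_on with
  | empty => simp [sumSq]
  | cons a s ih =>
    simp only [sumSq, Multiset.map_cons, Multiset.sum_cons] at ih ⊢
    nlinarith [Nat.zero_le (a * s.sum)]

/-- `IsPosition s`: every piece of `s` is one of `F 1, F 2, …`. -/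
def IsPosition (s : Multiset ℕ) : Prop := ∀ a ∈ s, ∃ k, 1 ≤ k ∧ a = F k

theorem exists_one_le_F_eq (k : ℕ) : ∃ j, 1 ≤ j ∧ F k = F j := by
  rcases k with _ | k
  · exact ⟨1, le_rfl, rfl⟩
  · exact ⟨k + 1, by omega, rfl⟩

theorem Combine.isPosition {s t : Multiset ℕ} (h : Combine s t) (hs : IsPosition s) :
    IsPosition t := by
  obtain ⟨k, u, hk, rfl, rfl⟩ := h
  intro a ha
  rcases Multiset.mem_cons.1 ha with rfl | ha
  · exact exists_one_le_F_eq _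
  · exact hs a (by simp [ha])

theorem Split.isPosition {s t : Multiset ℕ} (h : Split s t) (hs : IsPosition s) :
    IsPosition t := by
  obtain ⟨k, u, hk, rfl, rfl⟩ := h
  intro a ha
  simp only [Multiset.mem_cons] at ha
  rcases ha with rfl | rfl | ha
  · exact exists_one_le_F_eq _
  · exact exists_one_le_F_eq _
  · exact hs a (by simp [ha])

/-- `Play c d s t`: the position `t` can be reached from `s` by `c` combining and `d` splitting
moves. -/
inductive Play : ℕ → ℕ → Multiset ℕ → Multiset ℕ → Prop
  | refl (s : Multiset ℕ) : Play 0 0 s s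
  | combine {c d : ℕ} {s t u : Multiset ℕ} : Play c d s t → Combine t u → Play (c + 1) d s u
  | split {c d : ℕ} {s t u : Multiset ℕ} : Play c d s t → Split t u → Play c (d + 1) s u

namespace Play

variable {c d : ℕ} {s t : Multiset ℕ}

theorem sum_eq (h : Play c d s t) : t.sum = s.sum := by
  induction h with
  | refl => rfl
  | combine _ h ih => rw [h.sum_eq, ih]
  | split _ h ih => rw [h.sum_eq, ih]

theorem card_eq (h : Play c d s t) : s.card = t.card + c := by
  induction h with
  | refl => rfl
  | combine _ h ih => rw [ih, h.card_eq]; omega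
  | split _ h ih => rw [ih, h.card_eq]

theorem sumSq_le (h : Play c d s t) : c + d + sumSq s ≤ sumSq t := by
  induction h with
  | refl => simp
  | combine _ h ih => have := h.sumSq_lt; omega
  | split _ h ih => have := h.sumSq_lt; omega

theorem isPosition (h : Play c d s t) (hs : IsPosition s) : IsPosition t := by
  induction h with
  | refl => exact hs
  | combine _ h ih => exact h.isPosition (ih hs)
  | split _ h ih => exact h.isPosition (ih hs)

theorem trans {c' d' : ℕ} {u : Multiset ℕ} (h : Play c d s t) (h' : Play c' d' t u) :
    Play (c + c') (d + d') s u := by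
  induction h' with
  | refl => exact h
  | combine _ hm ih => exact (ih h).combine hm
  | split _ hm ih => exact (ih h).split hm

/-! ### Removing splitting moves -/

theorem exists_first_split (h : Play c (d + 1) s t) :
    ∃ c₁ c₂ u v, c = c₁ + c₂ ∧ Play c₁ 0 s u ∧ Split u v ∧ Play c₂ d v t := by
  generalize he : d + 1 = e at h
  induction h generalizing d with
  | refl => omega
  | combine _ hm ih =>
    obtain ⟨c₁, c₂, u, v, rfl, hu, huv, hv⟩ := ih he
    exact ⟨c₁, c₂ + 1, u, v, rfl, hu, huv, hv.combine hm⟩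
  | @split c e s t u h hm ih =>
    obtain rfl : d = e := by omega
    rcases d with _ | d
    · exact ⟨c, 0, t, u, rfl, h, hm, refl _⟩
    · obtain ⟨c₁, c₂, u, v, rfl, hu, huv, hv⟩ := ih rfl
      exact ⟨c₁, c₂, u, v, rfl, hu, huv, hv.split hm⟩

/-- In a play from copies of `F 1` by combining moves only, any one piece `F k` with `2 ≤ k` can be
left uncombined. -/
theorem uncombine {N k : ℕ} (hk : 2 ≤ k) {w : Multiset ℕ}
    (h : Play c 0 (Multiset.replicate N (F 1)) (F k ::ₘ w)) :
    ∃ c', c = c' + 1 ∧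
      Play c' 0 (Multiset.replicate N (F 1)) (F (k - 2) ::ₘ F (k - 1) ::ₘ w) := by
  generalize hs : Multiset.replicate N (F 1) = s at h
  generalize hd : 0 = d at h
  generalize ht : F k ::ₘ w = t at h
  induction h generalizing w with
  | refl s =>
    have : F k ∈ Multiset.replicate N (F 1) := by rw [hs, ← ht]; simp
    have := F_inj (by omega) le_rfl (Multiset.eq_of_mem_replicate this)
    omega
  | @combine c d s t u h hm ih =>
    obtain ⟨j, x, hj, rfl, rfl⟩ := hm
    -- Either the last move made the chosen F k and is dropped, or it left that piece untouched and
    -- still applies once the piece is uncombined.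
    rcases Multiset.cons_eq_cons.1 ht with ⟨hF, rfl⟩ | ⟨-, y, rfl, rfl⟩
    · obtain rfl := F_inj (by omega) (by omega) hF
      exact ⟨c, rfl, h⟩
    · obtain ⟨c', rfl, h'⟩ := ih (w := F (j - 1) ::ₘ F j ::ₘ y) hs hd
        (by simp only [← Multiset.singleton_add]; abel)
      refine ⟨c' + 1, rfl, h'.combine ⟨j, F (k - 2) ::ₘ F (k - 1) ::ₘ y, hj, ?_, ?_⟩⟩ <;>
        simp only [← Multiset.singleton_add] <;> abel
  | split => omega

/-- The new combining move replaces the omitted one, so `c` is unchanged. -/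
theorem remove_split {N : ℕ} (h : Play c (d + 1) (Multiset.replicate N (F 1)) t) :
    Play c d (Multiset.replicate N (F 1)) t := by
  obtain ⟨c₁, c₂, u, v, rfl, hu, ⟨k, w, hk, rfl, rfl⟩, hv⟩ := h.exists_first_split
  obtain ⟨c', rfl, h'⟩ := hu.uncombine hk
  have := (h'.combine (u := F (k - 2) ::ₘ F (k + 1) ::ₘ w)
    ⟨k, F (k - 2) ::ₘ w, by omega, by simp only [← Multiset.singleton_add]; abel,
      by simp only [← Multiset.singleton_add]; abel⟩).trans hv
  rwa [zero_add] at this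

theorem remove_splits {N d' : ℕ} (hd : d' ≤ d) (h : Play c d (Multiset.replicate N (F 1)) t) :
    Play c d' (Multiset.replicate N (F 1)) t := by
  induction d, hd using Nat.le_induction with
  | base => exact h
  | succ d _ ih => exact ih h.remove_split

theorem exists_terminal (s : Multiset ℕ) : ∃ c d t, Play c d s t ∧ ∀ u, ¬ Move t u := by
  induction hn : s.sum ^ 2 - sumSq s using Nat.strong_induction_on generalizing s with
  | _ n ih =>
    by_cases hs : ∃ u, Move s u
    · obtain ⟨u, hu⟩ := hs
      have hle := ZeckendorfGame.sumSq_le u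
      rcases move_iff.1 hu with hm | hm
      · have hlt := hm.sumSq_lt
        rw [hm.sum_eq] at hle
        obtain ⟨c, d, t, h, ht⟩ := ih (s.sum ^ 2 - sumSq u) (by omega) u (by rw [hm.sum_eq])
        exact ⟨_, _, t, ((refl s).combine hm).trans h, ht⟩
      · have hlt := hm.sumSq_lt
        rw [hm.sum_eq] at hle
        obtain ⟨c, d, t, h, ht⟩ := ih (s.sum ^ 2 - sumSq u) (by omega) u (by rw [hm.sum_eq])
        exact ⟨_, _, t, ((refl s).split hm).trans h, ht⟩
    · exact ⟨0, 0, s, refl s, not_exists.1 hs⟩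

theorem exists_relSeries (h : Play c d s t) :
    ∃ p : RelSeries {p : Multiset ℕ × Multiset ℕ | Move p.1 p.2},
      p.head = s ∧ p.last = t ∧ p.length = c + d := by
  induction h with
  | refl s => exact ⟨RelSeries.singleton _ s, rfl, rfl, rfl⟩
  | @combine c d s t u _ hm ih =>
    obtain ⟨p, hp, rfl, hl⟩ := ih
    refine ⟨p.snoc u (move_iff.2 (Or.inl hm)), by simp [hp], by simp, ?_⟩
    simp [hl]; omega
  | @split c d s t u _ hm ih =>
    obtain ⟨p, hp, rfl, hl⟩ := ih
    refine ⟨p.snoc u (move_iff.2 (Or.inr hm)), by simp [hp], by simp, ?_⟩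
    simp [hl]; omega

end Play

/-! ### Games as plays, and terminal positions -/

theorem exists_play_of_relSeries (p : RelSeries {p : Multiset ℕ × Multiset ℕ | Move p.1 p.2}) :
    ∃ c d, c + d = p.length ∧ Play c d p.head p.last := by
  have key : ∀ (i : ℕ) (hi : i < p.length + 1), ∃ c d, c + d = i ∧ Play c d p.head (p ⟨i, hi⟩) := by
    intro i
    induction i with
    | zero => exact fun _ => ⟨0, 0, rfl, Play.refl _⟩
    | succ i ih =>
      intro hi
      obtain ⟨c, d, hcd, h⟩ := ih (by omega)
      rcases move_iff.1 (p.step ⟨i, by omega⟩) with hm | hm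
      · exact ⟨c + 1, d, by omega, h.combine hm⟩
      · exact ⟨c, d + 1, by omega, h.split hm⟩
  exact key p.length (by omega)

theorem mem_gameLengths {N m : ℕ} : m ∈ gameLengths N ↔
    ∃ c d t, c + d = m ∧ Play c d (Multiset.replicate N (F 1)) t ∧ ∀ u, ¬ Move t u := by
  constructor
  · rintro ⟨g, rfl⟩
    obtain ⟨c, d, hcd, h⟩ := exists_play_of_relSeries g.toRelSeries
    exact ⟨c, d, _, hcd, g.start ▸ h, g.terminal⟩
  · rintro ⟨c, d, t, rfl, h, ht⟩
    obtain ⟨p, hp, rfl, hl⟩ := h.exists_relSeries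
    exact ⟨⟨p, hp, ht⟩, hl⟩

/-- A position without moves is the Zeckendorf decomposition of its sum. -/
theorem card_of_terminal {s : Multiset ℕ} (hs : IsPosition s) (ht : ∀ u, ¬ Move s u) :
    s.card = Z s.sum := by
  choose! f hf using hs
  -- The shift by 1 passes from the indexing of `F` to that of `Nat.fib`.
  set l : List ℕ := (s.map fun a => f a + 1).sort (· ≥ ·) with hl
  have hmap : (l.map Nat.fib : Multiset ℕ) = s := by
    rw [← Multiset.map_coe, hl, Multiset.sort_eq, Multiset.map_map]
    conv_rhs => rw [← Multiset.map_id s]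
    exact Multiset.map_congr rfl fun a ha => (hf a ha).2.symm
  have hone : ∀ i ∈ l, 2 ≤ i := by
    intro i hi
    rw [hl, Multiset.mem_sort, Multiset.mem_map] at hi
    obtain ⟨a, ha, rfl⟩ := hi
    have := (hf a ha).1
    omega
  have hgap : l.Pairwise fun a b => b + 2 ≤ a := by
    have hsort : l.Pairwise (· ≥ ·) := Multiset.pairwise_sort _ _
    refine List.pairwise_iff_forall_sublist.2 fun {a b} hab => ?_
    have hle : b ≤ a := List.pairwise_iff_forall_sublist.1 hsort hab
    have hb : 2 ≤ b := hone b (hab.subset (by simp))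
    by_contra hlt
    obtain ⟨u, hu⟩ : ∃ u, s = Nat.fib a ::ₘ Nat.fib b ::ₘ u := by
      have : ([Nat.fib a, Nat.fib b] : Multiset ℕ) ≤ s := by
        rw [← hmap]
        exact Multiset.coe_le.2 (hab.map Nat.fib).subperm
      obtain ⟨u, hu⟩ := Multiset.le_iff_exists_add.1 this
      exact ⟨u, by rw [hu, ← Multiset.cons_coe, ← Multiset.cons_coe]; simp⟩
    obtain ⟨b, rfl⟩ := Nat.exists_eq_add_of_le' hb
    -- Equal pieces allow F 1 ∧ F 1 or a split; consecutive pieces can be combined.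
    obtain rfl | rfl : a = b + 2 ∨ a = b + 3 := by omega
    · rcases b with _ | b
      · exact ht _ (move_iff.2 (Or.inl ⟨1, u, le_rfl, hu, rfl⟩))
      · exact ht _ (move_iff.2 (Or.inr ⟨b + 2, u, by omega, hu, rfl⟩))
    · exact ht _ (move_iff.2 (Or.inl ⟨b + 2, u, by omega, hu.trans (Multiset.cons_swap _ _ _), rfl⟩))
  have hrep : l.IsZeckendorfRep := by
    -- `List.IsZeckendorfRep` appends 0 to the list, so the last gap says that all indices are at
    -- least 2.
    refine List.Pairwise.isChain (List.pairwise_append.2 ⟨hgap, by simp, ?_⟩)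
    simpa using hone
  have hsum : (l.map Nat.fib).sum = s.sum := by rw [← hmap, Multiset.sum_coe]
  rw [Z, ← hsum, Nat.zeckendorf_sum_fib hrep, ← hmap]
  simp

theorem Play.combines_eq {N c d : ℕ} {t : Multiset ℕ}
    (h : Play c d (Multiset.replicate N (F 1)) t) (ht : ∀ u, ¬ Move t u) : c = N - Z N := by
  have hpos : IsPosition t := h.isPosition fun a ha =>
    ⟨1, le_rfl, Multiset.eq_of_mem_replicate ha⟩
  have hsum : t.sum = N := by simp [h.sum_eq, F]
  have hcard := h.card_eq
  rw [card_of_terminal hpos ht, hsum, Multiset.card_replicate] at hcard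
  omega

theorem length_le_sq_of_mem_gameLengths {N m : ℕ} (hm : m ∈ gameLengths N) : m ≤ N ^ 2 := by
  obtain ⟨c, d, t, rfl, h, -⟩ := mem_gameLengths.1 hm
  have hsum : t.sum = N := by simp [h.sum_eq, F]
  have := h.sumSq_le
  have := ZeckendorfGame.sumSq_le t
  rw [hsum] at this
  omega

end ZeckendorfGame

theorem theorem1p7 (N : ℕ) (hN : 1 ≤ N) :
    ∃ M : ℕ, IsGreatest (ZeckendorfGame.gameLengths N) M ∧
      ZeckendorfGame.gameLengths N = Set.Icc (N - ZeckendorfGame.Z N) M := by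
  open ZeckendorfGame in
  have hne : (gameLengths N).Nonempty := by
    obtain ⟨c, d, t, h, ht⟩ := Play.exists_terminal (Multiset.replicate N (F 1))
    exact ⟨c + d, mem_gameLengths.2 ⟨c, d, t, rfl, h, ht⟩⟩
  have hbdd : BddAbove (gameLengths N) := ⟨N ^ 2, fun m => length_le_sq_of_mem_gameLengths⟩
  have hM : IsGreatest (gameLengths N) (sSup (gameLengths N)) :=
    ⟨Nat.sSup_mem hne hbdd, fun m hm => le_csSup hbdd hm⟩
  refine ⟨_, hM, Set.ext fun m => ⟨fun hm => ⟨?_, hM.2 hm⟩, fun ⟨hlo, hhi⟩ => ?_⟩⟩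
  · obtain ⟨c, d, t, rfl, h, ht⟩ := mem_gameLengths.1 hm
    have := h.combines_eq ht
    omega
  · obtain ⟨c, d, t, hcd, h, ht⟩ := mem_gameLengths.1 hM.1
    have hc := h.combines_eq ht
    -- A longest game keeps m - c of its splits; here c = N - Z N ≤ m.
    exact mem_gameLengths.2 ⟨c, m - c, t, by omega, h.remove_splits (by omega), ht⟩
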